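/- **Setting.** Let $m,n\ge 0$ be integers. Indices run over $\{1,\dots,m+n\}$; put $[a]=0$ if $a\le m$ and $[a]=1$ if $a>m$. Over the field $\mathbb{Q}(q)$ put $q_a=q^{(-1)^{[a]}}$ and $\Delta_a=q_a-q_a^{-1}$. Let $U_q[gl(m|n)]$ be the associative unital $\mathbb{Q}(q)$-algebra generated by $K_a^{\pm1}$ and ${E^a}_b$ ($a\ne b$) subject to the relations below, where ${E^a}_b$ has degree $[{E^a}_b]=[a]+[b]\pmod 2$, $K_a^{\pm1}$ has degree $0$, and $[X,Y]=XY-(-1)^{[X][Y]}YX$ for homogeneous $X,Y$. Write $\overline K_a=K_a^{-1}$. Each relation is imposed for all indices for which every symbol in it is defined. 1. $K_a\overline K_a=\overline K_aK_a=1$, and all $K_a^{\pm1}$ commute with each other. 2. For every $c$ strictly between $a$ and $b$: ${E^a}_b={E^a}_c{E^c}_b-q_c^{\operatorname{sign}(a-b)}{E^c}_b{E^a}_c$. 3. $K_a{E^b}_{b\pm1}=q_a^{\delta_{a,b}-\delta_{a,b\pm1}}{E^b}_{b\pm1}K_a$. 4. $[{E^a}_{a+1},{E^{b+1}}_b]=\delta_{a,b}\,\Delta_a^{-1}(K_a\overline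 K_{a+1}-\overline K_aK_{a+1})$; and for $|a-b|>1$, ${E^{a+1}}_a$ commutes with ${E^{b+1}}_b$ and ${E^a}_{a+1}$ commutes with ${E^b}_{b+1}$. 5. $({E^m}_{m+1})^2=({E^{m+1}}_m)^2=0$. 6. For $a\ne m$: ${E^{a+1}}_a{E^{a+2}}_a=q_a{E^{a+2}}_a{E^{a+1}}_a$, ${E^a}_{a+1}{E^a}_{a+2}=q_a{E^a}_{a+2}{E^a}_{a+1}$, ${E^{a+1}}_{a-1}{E^{a+1}}_a=q_a{E^{a+1}}_a{E^{a+1}}_{a-1}$, ${E^{a-1}}_{a+1}{E^a}_{a+1}=q_a{E^a}_{a+1}{E^{a-1}}_{a+1}$. 7. If $m,n\ge 2$: $[{E^{m+1}}_m,{E^{m+2}}_{m-1}]=[{E^m}_{m+1},{E^{m-1}}_{m+2}]=0$. **Lemma 2.** The following identities hold in $U_q[gl(m|n)]$. *Two indices.* For all $a,b$ (for $a=b$ both sides are $0$): $$[{E^a}_b,{E^b}_a]=\Delta_a^{-1}(K_a\overline K_b-\overline K_aK_b).$$ *Three distinct indices.* $$[{E^a}_c,{E^c}_b]=\begin{cases}\overline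 K_bK_c{E^a}_b & c<b<a\\ {E^a}_bK_a\overline K_c & c<a<b\\ {E^a}_b\overline K_aK_c & b<a<c\\ K_b\overline K_c{E^a}_b & a<b<c,\end{cases}$$ $$[{E^c}_a,{E^c}_b]=[{E^a}_c,{E^b}_c]=0\qquad\text{if } a<c<b \text{ or } b<c<a,$$ $${E^c}_a{E^c}_b=\begin{cases}(-1)^{[{E^c}_b]}q_c{E^c}_b{E^c}_a & a<b<c\\ (-1)^{[{E^c}_a]}q_c{E^c}_b{E^c}_a & c<a<b,\end{cases}\qquad {E^a}_c{E^b}_c=\begin{cases}(-1)^{[{E^b}_c]}q_c{E^b}_c{E^a}_c & a<b<c\\ (-1)^{[{E^a}_c]}q_c{E^b}_c{E^a}_c & c<a<b.\end{cases}$$ *Four distinct indices*, with $a<b$ and $c<d$. If $a<c<d<b$, $a<b<c<d$, $c<a<b<d$ or $c<d<a<b$, then $$[{E^a}_b,{E^c}_d]=[{E^a}_b,{E^d}_c]=[{E^b}_a,{E^c}_d]=[{E^b}_a,{E^d}_c]=0.$$ If $a<c<b<d$, then $$[{E^a}_b,{E^c}_d]=\Delta_b{E^a}_d{E^c}_b,\qquad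 [{E^b}_a,{E^d}_c]=\Delta_b{E^d}_a{E^b}_c,$$ $$[{E^a}_b,{E^d}_c]=-\Delta_b\overline K_bK_c{E^a}_c{E^d}_b,\qquad [{E^b}_a,{E^c}_d]=-\Delta_c{E^b}_d{E^c}_a\overline K_cK_b.$$ If $c<a<d<b$, then $$[{E^a}_b,{E^c}_d]=-\Delta_d{E^a}_d{E^c}_b,\qquad [{E^b}_a,{E^d}_c]=-\Delta_d{E^d}_a{E^b}_c,$$ $$[{E^a}_b,{E^d}_c]=\Delta_d{E^d}_b{E^a}_c\overline K_aK_d,\qquad [{E^b}_a,{E^c}_d]=\Delta_a\overline K_dK_a{E^c}_a{E^b}_d.$$ -/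

import Mathlib

namespace UqGL

/-- The ground field `ℚ(q)`, the field of fractions of `ℤ[q, q⁻¹]`. -/
abbrev 𝕂 : Type := RatFunc ℚ

/-- The indices `1, …, m + n` of `gl(m|n)`. -/
abbrev Idx (m n : ℕ) : Type := {a : ℕ // 1 ≤ a ∧ a ≤ m + n}

/-- The grading `[a]` of an index: `0` for `a ≤ m` and `1` for `a > m`. -/
def par {m n : ℕ} (a : Idx m n) : ℕ := if (a : ℕ) ≤ m then 0 else 1

/-- The grading `[E^a_b] = [a] + [b] (mod 2)`. -/
def degE {m n : ℕ} (a b : Idx m n) : ℕ := (par a + par b) % 2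

noncomputable section

/-- The indeterminate `q`. -/
def q : 𝕂 := RatFunc.X

/-- `q_a = q ^ ((-1) ^ [a])`. -/
def qi {m n : ℕ} (a : Idx m n) : 𝕂 := q ^ ((-1 : ℤ) ^ par a)

/-- `Δ_a = q_a - q_a⁻¹`. -/
def Dl {m n : ℕ} (a : Idx m n) : 𝕂 := qi a - (qi a)⁻¹

/-- The graded commutator `X Y - (-1) ^ (i j) Y X` of homogeneous elements `X`, `Y` of degrees
`i`, `j`. -/
def gcomm {A : Type} [Ring A] (i j : ℕ) (X Y : A) : A := X * Y - (-1) ^ (i * j) * (Y * X)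

/-- The symbols `K_a`, `K_a⁻¹` and `E^a_b` (`a ≠ b`). -/
inductive Gen (m n : ℕ) : Type
  | K (a : Idx m n) : Gen m n
  | Kinv (a : Idx m n) : Gen m n
  | E (a b : Idx m n) (h : a ≠ b) : Gen m n

/-- The free associative algebra on these symbols. -/
abbrev Free (m n : ℕ) : Type := FreeAlgebra 𝕂 (Gen m n)

namespace Free

variable {m n : ℕ}

def K (a : Idx m n) : Free m n := FreeAlgebra.ι 𝕂 (Gen.K a)

def Kinv (a : Idx m n) : Free m n := FreeAlgebra.ι 𝕂 (Gen.Kinv a)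

/-- The free symbol `E^a_b` for `a ≠ b`. There is no symbol `E^a_a`; the value there is `0`. -/
def E (a b : Idx m n) : Free m n :=
  if h : a ≠ b then FreeAlgebra.ι 𝕂 (Gen.E a b h) else 0

/-- The graded commutator of `E^a_b` and `E^c_d`. -/
def brE (a b c d : Idx m n) : Free m n := gcomm (degE a b) (degE c d) (E a b) (E c d)

end Free

open Free in
/-- The defining relations of `U_q[gl(m|n)]`. In the constructors, `a'` stands for `a + 1` and
`a''` for `a + 2`. -/
inductive Rel (m n : ℕ) : Free m n → Free m n → Prop
  /- The Cartan generators are invertible and commute. -/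
  | K_mul_Kinv (a : Idx m n) : Rel m n (K a * Kinv a) 1
  | Kinv_mul_K (a : Idx m n) : Rel m n (Kinv a * K a) 1
  | K_K (a b : Idx m n) : Rel m n (K a * K b) (K b * K a)
  | K_Kinv (a b : Idx m n) : Rel m n (K a * Kinv b) (Kinv b * K a)
  | Kinv_Kinv (a b : Idx m n) : Rel m n (Kinv a * Kinv b) (Kinv b * Kinv a)
  /- Definition of the nonsimple generators, for any index `c` strictly between `a` and `b`:
  `E^a_b = E^a_c E^c_b - q_c ^ sign(a - b) E^c_b E^a_c`. -/
  | nonsimple_raising (a c b : Idx m n) (hac : a < c) (hcb : c < b) :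
      Rel m n (E a b) (E a c * E c b - (qi c)⁻¹ • (E c b * E a c))
  | nonsimple_lowering (a c b : Idx m n) (hbc : b < c) (hca : c < a) :
      Rel m n (E a b) (E a c * E c b - qi c • (E c b * E a c))
  /- The Cartan generators and the simple generators `E^b_{b ± 1}`. -/
  | K_E (a b c : Idx m n) (hbc : (c : ℕ) = b + 1 ∨ (b : ℕ) = c + 1) :
      Rel m n (K a * E b c)
        (qi a ^ ((if a = b then 1 else 0) - (if a = c then 1 else 0) : ℤ) • (E b c * K a))
  /- Simple raising against simple lowering generators. -/
  | raise_lower (a a' b b' : Idx m n) (ha : (a' : ℕ) = a + 1) (hb : (b' : ℕ) = b + 1) :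
      Rel m n (brE a a' b' b)
        (if a = b then (Dl a)⁻¹ • (K a * Kinv a' - Kinv a * K a') else 0)
  /- Distant simple generators commute. -/
  | distant_lowering (a a' b b' : Idx m n) (ha : (a' : ℕ) = a + 1) (hb : (b' : ℕ) = b + 1)
      (hab : (a : ℕ) + 1 < b ∨ (b : ℕ) + 1 < a) :
      Rel m n (E a' a * E b' b) (E b' b * E a' a)
  | distant_raising (a a' b b' : Idx m n) (ha : (a' : ℕ) = a + 1) (hb : (b' : ℕ) = b + 1)
      (hab : (a : ℕ) + 1 < b ∨ (b : ℕ) + 1 < a) :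
      Rel m n (E a a' * E b b') (E b b' * E a a')
  /- The odd simple generators square to zero. -/
  | sq_raising (a a' : Idx m n) (ha : (a : ℕ) = m) (ha' : (a' : ℕ) = a + 1) :
      Rel m n (E a a' ^ 2) 0
  | sq_lowering (a a' : Idx m n) (ha : (a : ℕ) = m) (ha' : (a' : ℕ) = a + 1) :
      Rel m n (E a' a ^ 2) 0
  /- The Serre relations, whenever the indices involved exist. -/
  | serre_a (a a' a'' : Idx m n) (hm : (a : ℕ) ≠ m) (ha' : (a' : ℕ) = a + 1)
      (ha'' : (a'' : ℕ) = a + 2) :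
      Rel m n (E a' a * E a'' a) (qi a • (E a'' a * E a' a))
  | serre_b (a a' a'' : Idx m n) (hm : (a : ℕ) ≠ m) (ha' : (a' : ℕ) = a + 1)
      (ha'' : (a'' : ℕ) = a + 2) :
      Rel m n (E a a' * E a a'') (qi a • (E a a'' * E a a'))
  | serre_c (z a a' : Idx m n) (hm : (a : ℕ) ≠ m) (hz : (a : ℕ) = z + 1)
      (ha' : (a' : ℕ) = a + 1) :
      Rel m n (E a' z * E a' a) (qi a • (E a' a * E a' z))
  | serre_d (z a a' : Idx m n) (hm : (a : ℕ) ≠ m) (hz : (a : ℕ) = z + 1)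
      (ha' : (a' : ℕ) = a + 1) :
      Rel m n (E z a' * E a a') (qi a • (E a a' * E z a'))
  /- The additional Serre relations around the odd node (here `z = m - 1`, `a = m`). -/
  | serre_odd_lowering (z a a' a'' : Idx m n) (hm : (a : ℕ) = m) (hz : (a : ℕ) = z + 1)
      (ha' : (a' : ℕ) = a + 1) (ha'' : (a'' : ℕ) = a + 2) :
      Rel m n (brE a' a a'' z) 0
  | serre_odd_raising (z a a' a'' : Idx m n) (hm : (a : ℕ) = m) (hz : (a : ℕ) = z + 1)
      (ha' : (a' : ℕ) = a + 1) (ha'' : (a'' : ℕ) = a + 2) :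
      Rel m n (brE a a' z a'') 0

/-- The quantum superalgebra `U_q[gl(m|n)]`, as an associative algebra over `ℚ(q)`. -/
abbrev U (m n : ℕ) : Type := RingQuot (Rel m n)

variable {m n : ℕ}

/-- The Cartan generator `K_a`. -/
def K (a : Idx m n) : U m n := RingQuot.mkAlgHom 𝕂 (Rel m n) (Free.K a)

/-- The inverse `K_a⁻¹` of the Cartan generator `K_a`. -/
def Kinv (a : Idx m n) : U m n := RingQuot.mkAlgHom 𝕂 (Rel m n) (Free.Kinv a)

/-- The generator `E^a_b` for `a ≠ b`, simple or not (and `0` for `a = b`). -/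
def E (a b : Idx m n) : U m n := RingQuot.mkAlgHom 𝕂 (Rel m n) (Free.E a b)

/-- The graded commutator `[E^a_b, E^c_d]` in `U_q[gl(m|n)]`. -/
def brE (a b c d : Idx m n) : U m n := gcomm (degE a b) (degE c d) (E a b) (E c d)

end

end UqGL

namespace UqGL

open MulOpposite OrderDual

/-! Everything reduces to manipulating q-brackets. A nonsimple generator is a q-bracket of two
shorter ones, and an element commuting up to scalars with both factors commutes up to the product of
the scalars with the bracket (`mul_bracket`). Induction on the number of indices between the
endpoints (`lt_induction`) thus carries weights and commutation rules from simple to arbitrary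
generators.

Among raising generators the essential fact is that a simple generator supercommutes with any
generator whose interval strictly contains its own. At an even node this follows from the Serre
relations and `q ^ 2 ≠ -1` (`commute_of_serre`); at the odd node it comes from the additional Serre
relation. The nested, common-endpoint and overlapping rules follow by expanding one bracket.

For raising against lowering, the two- and three-index formulas feed each other: the two-index
formula on a short interval gives three-index formulas, and these give the two-index formula on a
longer interval, where the Cartan terms telescope. The mixed four-index rules then come from
splitting one generator at an endpoint of the other.

Two symmetries cut the work by about four: `rev` reverses the order of the indices, `opp` reverses
products and exchanges raising with lowering. Both invert `q` and swap `K` with `Kinv`. Reversal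
leaves the interval of naturals, hence the presentation over an abstract linear order, where the
grading enters only through a parity that jumps at most once. -/

/-- Generators and relations of `U_q[gl(m|n)]` over an arbitrary linearly ordered index set `I`, in
a form that is stable under reversing the order of `I` and the multiplication of the algebra. -/
structure GLSystem (F A I : Type*) [Field F] [Ring A] [Algebra F A] [LinearOrder I] where
  par : I → ℕ
  q : I → F
  K : I → A
  Kinv : I → A
  E : I → I → A
  par_le : ∀ a, par a ≤ 1
  par_convex : ∀ a b c, a < b → b < c → par a = par b ∨ par b = par c
  q_ne_zero : ∀ a, q a ≠ 0
  q_eq : ∀ a b, par a = par b → q b = q a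
  q_inv : ∀ a b, par a ≠ par b → q b = (q a)⁻¹
  sq_sub_ne : ∀ a, q a ^ 2 - 1 ≠ 0
  sq_add_ne : ∀ a, q a ^ 2 + 1 ≠ 0
  K_mul_Kinv : ∀ a, K a * Kinv a = 1
  Kinv_mul_K : ∀ a, Kinv a * K a = 1
  K_K : ∀ a b, K a * K b = K b * K a
  K_Kinv : ∀ a b, K a * Kinv b = Kinv b * K a
  Kinv_Kinv : ∀ a b, Kinv a * Kinv b = Kinv b * Kinv a
  raising : ∀ a c b, a < c → c < b → E a b = E a c * E c b - (q c)⁻¹ • (E c b * E a c)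
  lowering : ∀ a c b, b < c → c < a → E a b = E a c * E c b - q c • (E c b * E a c)
  K_E_covBy : ∀ a b c, b ⋖ c ∨ c ⋖ b →
    K a * E b c = q a ^ ((if a = b then 1 else 0) - (if a = c then 1 else 0) : ℤ) • (E b c * K a)
  raise_lower_ne : ∀ a a' b b', a ⋖ a' → b ⋖ b' → a ≠ b → a' ≠ b' →
    E a a' * E b' b =
      (-1 : F) ^ ((par a + par a') % 2 * ((par b' + par b) % 2)) • (E b' b * E a a')
  raise_lower_self : ∀ a a', a ⋖ a' →
    E a a' * E a' a =
      (-1 : F) ^ ((par a + par a') % 2 * ((par a' + par a) % 2)) • (E a' a * E a a') +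
        (q a - (q a)⁻¹)⁻¹ • (K a * Kinv a' - Kinv a * K a')
  distant_raising : ∀ a a' b b', a ⋖ a' → b ⋖ b' → a' < b → E a a' * E b b' = E b b' * E a a'
  distant_lowering : ∀ a a' b b', a ⋖ a' → b ⋖ b' → a' < b → E a' a * E b' b = E b' b * E a' a
  sq_raising : ∀ a a', a ⋖ a' → par a ≠ par a' → E a a' * E a a' = 0
  sq_lowering : ∀ a a', a ⋖ a' → par a ≠ par a' → E a' a * E a' a = 0
  serre_raising_left : ∀ a b c, a ⋖ b → b ⋖ c → par a = par b →
    E a b * E a c = q a • (E a c * E a b)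
  serre_raising_right : ∀ a b c, a ⋖ b → b ⋖ c → par b = par c →
    E a c * E b c = q b • (E b c * E a c)
  serre_lowering_left : ∀ a b c, a ⋖ b → b ⋖ c → par a = par b →
    E b a * E c a = q a • (E c a * E b a)
  serre_lowering_right : ∀ a b c, a ⋖ b → b ⋖ c → par b = par c →
    E c a * E c b = q b • (E c b * E c a)
  serre_odd_raising : ∀ a b c d, a ⋖ b → b ⋖ c → c ⋖ d → par b ≠ par c →
    E b c * E a d = -(E a d * E b c)
  serre_odd_lowering : ∀ a b c d, a ⋖ b → b ⋖ c → c ⋖ d → par b ≠ par c →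
    E c b * E d a = -(E d a * E c b)

/-! ### Quasi-commutation and q-brackets -/

section Bracket

variable {F A : Type*} [Field F] [Ring A] [Algebra F A]

theorem mul_bracket {X Y Z : A} {α β : F} (γ : F) (hY : X * Y = α • (Y * X))
    (hZ : X * Z = β • (Z * X)) :
    X * (Y * Z - γ • (Z * Y)) = (α * β) • ((Y * Z - γ • (Z * Y)) * X) := by
  have e1 : X * (Y * Z) = (α * β) • (Y * Z * X) := by
    rw [← mul_assoc, hY, smul_mul_assoc, mul_assoc, hZ, mul_smul_comm, smul_smul, mul_assoc]
  have e2 : X * (Z * Y) = (α * β) • (Z * Y * X) := by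
    rw [← mul_assoc, hZ, smul_mul_assoc, mul_assoc, hY, mul_smul_comm, smul_smul, mul_assoc,
      mul_comm β]
  rw [mul_sub, mul_smul_comm, e1, e2, sub_mul, smul_mul_assoc, smul_sub, smul_comm γ]

theorem mul_eq_smul_symm {X Y : A} {α : F} (hα : α ≠ 0) (h : X * Y = α • (Y * X)) :
    Y * X = α⁻¹ • (X * Y) := by
  rw [h, smul_smul, inv_mul_cancel₀ hα, one_smul]

theorem inv_mul_eq_smul {X Xi Y : A} {α : F} (hα : α ≠ 0) (h₁ : X * Xi = 1) (h₂ : Xi * X = 1)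
    (h : X * Y = α • (Y * X)) : Xi * Y = α⁻¹ • (Y * Xi) := by
  have : Xi * (X * Y) * Xi = α • (Xi * (Y * X) * Xi) := by
    rw [h, mul_smul_comm, smul_mul_assoc]
  rw [← mul_assoc, h₂, one_mul, mul_assoc Xi, mul_assoc Y, h₁, mul_one] at this
  rw [this, smul_smul, inv_mul_cancel₀ hα, one_smul]

end Bracket

theorem lt_induction {I : Type*} [LinearOrder I] [Finite I] {P : I → I → Prop}
    (cov : ∀ a b, a ⋖ b → P a b)
    (step : ∀ a c b, a < c → c < b → P a c → P c b → P a b) (a b : I) (hab : a < b) : P a b := by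
  induction h : (Set.Ioo a b).ncard using Nat.strong_induction_on generalizing a b with
  | _ k ih =>
    subst h
    by_cases hc : a ⋖ b
    · exact cov a b hc
    · obtain ⟨c, hac, hcb⟩ := exists_lt_lt_of_not_covBy hab hc
      refine step a c b hac hcb (ih _ ?_ a c hac rfl) (ih _ ?_ c b hcb rfl)
      · refine Set.ncard_lt_ncard ⟨Set.Ioo_subset_Ioo_right hcb.le, fun h => ?_⟩ (Set.toFinite _)
        exact lt_irrefl _ (h ⟨hac, hcb⟩).2
      · refine Set.ncard_lt_ncard ⟨Set.Ioo_subset_Ioo_left hac.le, fun h => ?_⟩ (Set.toFinite _)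
        exact lt_irrefl _ (h ⟨hac, hcb⟩).1

/-! ### Signs and the two symmetries of the presentation -/

namespace GLSystem

variable {F A I : Type*} [Field F] [Ring A] [Algebra F A] [LinearOrder I] (D : GLSystem F A I)

/-- The degree of `E^a_b`. -/
def deg (a b : I) : ℕ := (D.par a + D.par b) % 2

/-- The sign in the graded commutator of `E^a_b` and `E^c_d`. -/
def sg (a b c d : I) : F := (-1) ^ (D.deg a b * D.deg c d)

theorem deg_comm (a b : I) : D.deg a b = D.deg b a := by simp [deg, add_comm]

theorem par_cases (a : I) : D.par a = 0 ∨ D.par a = 1 := by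
  have := D.par_le a; omega

theorem sg_mul_self (a b c d : I) : D.sg a b c d * D.sg a b c d = 1 := by
  rw [sg, ← mul_pow]; simp

theorem sg_inv (a b c d : I) : (D.sg a b c d)⁻¹ = D.sg a b c d :=
  inv_eq_of_mul_eq_one_left (D.sg_mul_self a b c d)

theorem sg_comm (a b c d : I) : D.sg a b c d = D.sg c d a b := by rw [sg, sg, mul_comm]

theorem neg_one_pow_deg_mul (i : ℕ) (a c b : I) :
    (-1 : F) ^ (i * D.deg a c) * (-1) ^ (i * D.deg c b) = (-1) ^ (i * D.deg a b) := by
  simp only [deg]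
  rcases D.par_cases a with ha | ha <;> rcases D.par_cases b with hb | hb <;>
    rcases D.par_cases c with hc | hc <;> simp [ha, hb, hc, ← mul_pow]

/-- Parity jumps at most once, so of two intervals meeting in at most an endpoint at most one is
odd. -/
theorem sg_eq_one {a b c d : I} (hab : a < b) (hbc : b ≤ c) (hcd : c < d) :
    D.sg a b c d = 1 := by
  have h : D.par a = D.par b ∨ D.par c = D.par d := by
    rcases hbc.eq_or_lt with rfl | hbc
    · exact D.par_convex _ _ _ hab hcd
    · have h1 := D.par_convex _ _ _ hab hbc
      have h2 := D.par_convex _ _ _ hab (hbc.trans hcd)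
      have h3 := D.par_convex _ _ _ hbc hcd
      have h4 := D.par_convex _ _ _ (hab.trans hbc) hcd
      have ha := D.par_le a
      have hb := D.par_le b
      have hc := D.par_le c
      have hd := D.par_le d
      omega
  have hb := D.par_cases b
  have hc := D.par_cases c
  rcases h with h | h <;> simp only [sg, deg, h]
  · rcases hb with hb | hb <;> simp [hb]
  · rcases hc with hc | hc <;> rw [h] at hc <;> simp [hc]

theorem Kinv_E_covBy (a b c : I) (h : b ⋖ c ∨ c ⋖ b) :
    D.Kinv a * D.E b c = (D.q a)⁻¹ ^ ((if a = b then 1 else 0) - (if a = c then 1 else 0) : ℤ) •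
      (D.E b c * D.Kinv a) := by
  rw [inv_zpow]
  exact inv_mul_eq_smul (zpow_ne_zero _ (D.q_ne_zero a)) (D.K_mul_Kinv a) (D.Kinv_mul_K a)
    (D.K_E_covBy a b c h)

theorem delta_neg {x : F} : x⁻¹ - (x⁻¹)⁻¹ = -(x - x⁻¹) := by rw [inv_inv]; ring

theorem sq_inv_sub_ne {x : F} (hx : x ≠ 0) (h : x ^ 2 - 1 ≠ 0) : x⁻¹ ^ 2 - 1 ≠ 0 := by
  intro h'
  apply h
  field_simp at h'
  linear_combination -h'

theorem sq_inv_add_ne {x : F} (hx : x ≠ 0) (h : x ^ 2 + 1 ≠ 0) : x⁻¹ ^ 2 + 1 ≠ 0 := by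
  intro h'
  apply h
  field_simp at h'
  linear_combination h'

theorem serre_inv {X Y : A} {x y : F} (hxy : x = y) (hx : x ≠ 0)
    (h : X * Y = x • (Y * X)) : Y * X = y⁻¹ • (X * Y) :=
  hxy ▸ mul_eq_smul_symm hx h

/-- The sign is `-1` exactly when the parities differ, and then `q b = (q a)⁻¹` flips the sign of `q
a - (q a)⁻¹`. This makes the two-index formula symmetric in its indices. -/
theorem sg_mul_delta_inv (a b : I) :
    D.sg a b b a * (D.q a - (D.q a)⁻¹)⁻¹ = (D.q b - (D.q b)⁻¹)⁻¹ := by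
  by_cases hp : D.par a = D.par b
  · rw [D.q_eq a b hp, sg, deg, hp]
    rcases D.par_cases b with h | h <;> simp [h]
  · rw [D.q_inv a b hp, delta_neg, inv_neg, sg, deg, deg]
    rcases D.par_cases a with h | h <;> rcases D.par_cases b with h' | h' <;>
      simp [h, h'] at hp ⊢

/-- The formula for the graded commutator of `E^a_b` and `E^b_a`. -/
def TwoIndex (a b : I) : Prop :=
  D.E a b * D.E b a = D.sg a b b a • (D.E b a * D.E a b) +
    (D.q a - (D.q a)⁻¹)⁻¹ • (D.K a * D.Kinv b - D.Kinv a * D.K b)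

variable {D} in
theorem TwoIndex.symm {a b : I} (h : D.TwoIndex a b) : D.TwoIndex b a := by
  rw [TwoIndex] at h ⊢
  rw [D.sg_comm b a, h, smul_add, smul_smul, sg_mul_self, one_smul, add_assoc, smul_smul,
    sg_mul_delta_inv, D.K_Kinv a b, D.K_Kinv b a]
  module

/-- The system with the order of the indices reversed. -/
def rev : GLSystem F A Iᵒᵈ where
  par a := D.par (ofDual a)
  -- Reversal exchanges the raising and lowering recursions, whose coefficients are `(q c)⁻¹` and `q
  -- c`; the inverse compensates, and the weights then force `K` and `Kinv` to swap.
  q a := (D.q (ofDual a))⁻¹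
  K a := D.Kinv (ofDual a)
  Kinv a := D.K (ofDual a)
  E a b := D.E (ofDual a) (ofDual b)
  par_le a := D.par_le _
  par_convex a b c hab hbc := (D.par_convex _ _ _ hbc hab).symm.imp Eq.symm Eq.symm
  q_ne_zero a := inv_ne_zero (D.q_ne_zero _)
  q_eq a b h := by rw [D.q_eq _ _ h]
  q_inv a b h := by rw [D.q_inv _ _ h]
  sq_sub_ne a := sq_inv_sub_ne (D.q_ne_zero _) (D.sq_sub_ne _)
  sq_add_ne a := sq_inv_add_ne (D.q_ne_zero _) (D.sq_add_ne _)
  K_mul_Kinv a := D.Kinv_mul_K _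
  Kinv_mul_K a := D.K_mul_Kinv _
  K_K a b := D.Kinv_Kinv _ _
  K_Kinv a b := (D.K_Kinv _ _).symm
  Kinv_Kinv a b := D.K_K _ _
  raising a c b hac hcb := by rw [inv_inv]; exact D.lowering _ _ _ hcb hac
  lowering a c b hbc hca := D.raising _ _ _ hca hbc
  K_E_covBy a b c h := D.Kinv_E_covBy _ _ _ (h.symm.imp CovBy.ofDual CovBy.ofDual)
  raise_lower_ne a a' b b' ha hb hab hab' := by
    have := mul_eq_smul_symm (by simp) (D.raise_lower_ne (ofDual b') (ofDual b) (ofDual a')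
      (ofDual a) hb.ofDual ha.ofDual (Ne.symm hab') (Ne.symm hab))
    rw [this]
    congr 1
    rw [mul_comm]
    exact D.sg_inv _ _ _ _
  raise_lower_self a a' h := by
    have := TwoIndex.symm (D := D) (D.raise_lower_self (ofDual a') (ofDual a) h.ofDual)
    rw [delta_neg, inv_neg, neg_smul, ← smul_neg, neg_sub]
    exact this
  distant_raising a a' b b' ha hb hab :=
    (D.distant_lowering _ _ _ _ hb.ofDual ha.ofDual hab).symm
  distant_lowering a a' b b' ha hb hab :=
    (D.distant_raising _ _ _ _ hb.ofDual ha.ofDual hab).symm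
  sq_raising a a' h hp := D.sq_lowering _ _ h.ofDual (Ne.symm hp)
  sq_lowering a a' h hp := D.sq_raising _ _ h.ofDual (Ne.symm hp)
  serre_raising_left a b c hab hbc hp := serre_inv (D.q_eq _ _ hp) (D.q_ne_zero _)
    (D.serre_lowering_right _ _ _ hbc.ofDual hab.ofDual hp.symm)
  serre_raising_right a b c hab hbc hp := serre_inv (D.q_eq _ _ hp) (D.q_ne_zero _)
    (D.serre_lowering_left _ _ _ hbc.ofDual hab.ofDual hp.symm)
  serre_lowering_left a b c hab hbc hp := serre_inv (D.q_eq _ _ hp) (D.q_ne_zero _)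
    (D.serre_raising_right _ _ _ hbc.ofDual hab.ofDual hp.symm)
  serre_lowering_right a b c hab hbc hp := serre_inv (D.q_eq _ _ hp) (D.q_ne_zero _)
    (D.serre_raising_left _ _ _ hbc.ofDual hab.ofDual hp.symm)
  serre_odd_raising a b c d hab hbc hcd hp :=
    D.serre_odd_lowering _ _ _ _ hcd.ofDual hbc.ofDual hab.ofDual (Ne.symm hp)
  serre_odd_lowering a b c d hab hbc hcd hp :=
    D.serre_odd_raising _ _ _ _ hcd.ofDual hbc.ofDual hab.ofDual (Ne.symm hp)

/-- The system in the opposite algebra with raising and lowering generators exchanged. -/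
def opp : GLSystem F Aᵐᵒᵖ I where
  par := D.par
  q a := (D.q a)⁻¹
  K a := op (D.Kinv a)
  Kinv a := op (D.K a)
  E a b := op (D.E b a)
  par_le := D.par_le
  par_convex := D.par_convex
  q_ne_zero a := inv_ne_zero (D.q_ne_zero _)
  q_eq a b h := by rw [D.q_eq _ _ h]
  q_inv a b h := by rw [D.q_inv _ _ h]
  sq_sub_ne a := sq_inv_sub_ne (D.q_ne_zero _) (D.sq_sub_ne _)
  sq_add_ne a := sq_inv_add_ne (D.q_ne_zero _) (D.sq_add_ne _)
  K_mul_Kinv a := congrArg op (D.K_mul_Kinv _)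
  Kinv_mul_K a := congrArg op (D.Kinv_mul_K _)
  K_K a b := congrArg op (D.Kinv_Kinv _ _)
  K_Kinv a b := congrArg op (D.K_Kinv _ _)
  Kinv_Kinv a b := congrArg op (D.K_K _ _)
  raising a c b hac hcb := by
    rw [inv_inv]; exact congrArg op (D.lowering _ _ _ hac hcb)
  lowering a c b hbc hca := congrArg op (D.raising _ _ _ hbc hca)
  K_E_covBy a b c h := by
    have := mul_eq_smul_symm (zpow_ne_zero _ (inv_ne_zero (D.q_ne_zero a)))
      (D.Kinv_E_covBy a c b h.symm)
    rw [← zpow_neg, neg_sub] at this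
    exact congrArg op this
  raise_lower_ne a a' b b' ha hb hab hab' := by
    have := D.raise_lower_ne b b' a a' hb ha hab.symm hab'.symm
    rw [mul_comm, add_comm (D.par b), add_comm (D.par a')] at this
    exact congrArg op this
  raise_lower_self a a' h := by
    rw [delta_neg, inv_neg, neg_smul, ← smul_neg, neg_sub]
    have := D.raise_lower_self a a' h
    rw [D.K_Kinv a a', ← D.K_Kinv a' a] at this
    exact congrArg op this
  distant_raising a a' b b' ha hb hab := congrArg op (D.distant_lowering _ _ _ _ ha hb hab).symm
  distant_lowering a a' b b' ha hb hab := congrArg op (D.distant_raising _ _ _ _ ha hb hab).symm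
  sq_raising a a' h hp := congrArg op (D.sq_lowering _ _ h hp)
  sq_lowering a a' h hp := congrArg op (D.sq_raising _ _ h hp)
  serre_raising_left a b c hab hbc hp := congrArg op (serre_inv rfl (D.q_ne_zero _)
    (D.serre_lowering_left _ _ _ hab hbc hp))
  serre_raising_right a b c hab hbc hp := congrArg op (serre_inv rfl (D.q_ne_zero _)
    (D.serre_lowering_right _ _ _ hab hbc hp))
  serre_lowering_left a b c hab hbc hp := congrArg op (serre_inv rfl (D.q_ne_zero _)
    (D.serre_raising_left _ _ _ hab hbc hp))
  serre_lowering_right a b c hab hbc hp := congrArg op (serre_inv rfl (D.q_ne_zero _)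
    (D.serre_raising_right _ _ _ hab hbc hp))
  serre_odd_raising a b c d hab hbc hcd hp :=
    congrArg op (neg_eq_iff_eq_neg.2 (D.serre_odd_lowering _ _ _ _ hab hbc hcd hp)).symm
  serre_odd_lowering a b c d hab hbc hcd hp :=
    congrArg op (neg_eq_iff_eq_neg.2 (D.serre_odd_raising _ _ _ _ hab hbc hcd hp)).symm

end GLSystem

/-- Expanding `R` in its two ways gives `R * y = C + t⁻² • (y * R)` and `y * R = C + t⁻² • (R * y)`
with the same `C = t⁻¹ • (P * Q - Q * P)`. Subtracting, `1 + t⁻²` kills the commutator. -/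
theorem commute_of_serre {F A : Type*} [Field F] [Ring A] [Algebra F A] {x y z P Q R : A} {t : F}
    (ht : t ≠ 0) (ht' : t ^ 2 + 1 ≠ 0) (hP : P = x * y - t⁻¹ • (y * x))
    (hQ : Q = y * z - t⁻¹ • (z * y)) (hR : R = P * z - t⁻¹ • (z * P))
    (hR' : R = x * Q - t⁻¹ • (Q * x)) (hPy : P * y = t • (y * P)) (hyQ : y * Q = t • (Q * y)) :
    R * y = y * R := by
  have hQy := mul_eq_smul_symm ht hyQ
  have hyP := mul_eq_smul_symm ht hPy
  have hQy' (W : A) : Q * (y * W) = t⁻¹ • (y * (Q * W)) := by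
    rw [← mul_assoc, hQy, smul_mul_assoc, mul_assoc]
  have hyP' (W : A) : y * (P * W) = t⁻¹ • (P * (y * W)) := by
    rw [← mul_assoc, hyP, smul_mul_assoc, mul_assoc]
  have e1 : R * y = t⁻¹ • (P * Q - Q * P) + (t⁻¹ * t⁻¹) • (y * R) := by
    rw [hR', hP]
    simp only [mul_sub, sub_mul, smul_mul_assoc, mul_smul_comm, mul_assoc, hQy, hQy']
    module
  have e2 : y * R = t⁻¹ • (P * Q - Q * P) + (t⁻¹ * t⁻¹) • (R * y) := by
    rw [hR, hQ]
    simp only [mul_sub, sub_mul, smul_mul_assoc, mul_smul_comm, mul_assoc, hyP, hyP']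
    module
  have e3 : (1 + t⁻¹ * t⁻¹) • (R * y - y * R) = 0 := by
    linear_combination (norm := module) e1 - e2
  have h0 : 1 + t⁻¹ * t⁻¹ ≠ 0 := by
    intro h
    apply ht'
    field_simp at h
    linear_combination h
  exact sub_eq_zero.1 ((smul_eq_zero.1 e3).resolve_left h0)

/-! ### Weights, distant generators, and relations inside each triangular half -/

namespace GLSystem

variable {F A I : Type*} [Field F] [Ring A] [Algebra F A] [LinearOrder I] (D : GLSystem F A I)

variable [Finite I]

theorem K_E_of_lt (a b c : I) (h : b < c) : D.K a * D.E b c =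
    D.q a ^ ((if a = b then 1 else 0) - (if a = c then 1 else 0) : ℤ) • (D.E b c * D.K a) := by
  revert b c
  refine lt_induction (fun b c h => D.K_E_covBy a b c (.inl h)) fun b d c hbd hdc h1 h2 => ?_
  rw [D.raising b d c hbd hdc, mul_bracket _ h1 h2, ← zpow_add₀ (D.q_ne_zero a)]
  congr 2
  ring

theorem K_E (a b c : I) (h : b ≠ c) : D.K a * D.E b c =
    D.q a ^ ((if a = b then 1 else 0) - (if a = c then 1 else 0) : ℤ) • (D.E b c * D.K a) := by
  rcases h.lt_or_gt with h | h
  · exact D.K_E_of_lt a b c h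
  · have := inv_mul_eq_smul (zpow_ne_zero _ (inv_ne_zero (D.q_ne_zero a))) (D.Kinv_mul_K a)
      (D.K_mul_Kinv a) (D.rev.K_E_of_lt (toDual a) (toDual b) (toDual c) h)
    rw [inv_zpow, inv_inv] at this
    exact this

theorem K_mul_E_left {a b : I} (h : a ≠ b) : D.K a * D.E a b = D.q a • (D.E a b * D.K a) := by
  simpa [h] using D.K_E a a b h

theorem K_mul_E_right {a b : I} (h : a ≠ b) :
    D.K b * D.E a b = (D.q b)⁻¹ • (D.E a b * D.K b) := by
  simpa [h.symm] using D.K_E b a b h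

theorem K_mul_E_of_ne {a b c : I} (h : a ≠ b) (ha : c ≠ a) (hb : c ≠ b) :
    D.K c * D.E a b = D.E a b * D.K c := by
  simpa [ha, hb] using D.K_E c a b h

theorem Kinv_mul_E_right {a b : I} (h : a ≠ b) :
    D.Kinv b * D.E a b = D.q b • (D.E a b * D.Kinv b) := by
  simpa using inv_mul_eq_smul (inv_ne_zero (D.q_ne_zero b)) (D.K_mul_Kinv b) (D.Kinv_mul_K b)
    (D.K_mul_E_right h)

theorem Kinv_mul_E_of_ne {a b c : I} (h : a ≠ b) (ha : c ≠ a) (hb : c ≠ b) :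
    D.Kinv c * D.E a b = D.E a b * D.Kinv c := by
  simpa using inv_mul_eq_smul (F := F) one_ne_zero (D.K_mul_Kinv c) (D.Kinv_mul_K c)
    ((D.K_mul_E_of_ne h ha hb).trans (one_smul F _).symm)

/-- Graded commutation with a raising generator is inherited from the simple ones. -/
theorem mul_raising_of_covBy (X : A) (i : ℕ) {a b : I} (hab : a < b)
    (h : ∀ c d, a ≤ c → c ⋖ d → d ≤ b → X * D.E c d = (-1 : F) ^ (i * D.deg c d) • (D.E c d * X)) :
    X * D.E a b = (-1 : F) ^ (i * D.deg a b) • (D.E a b * X) := by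
  have key : ∀ c d, c < d → a ≤ c → d ≤ b →
      X * D.E c d = (-1 : F) ^ (i * D.deg c d) • (D.E c d * X) := by
    refine lt_induction (fun c d hcd hac hdb => h c d hac hcd hdb)
      fun c e d hce hed h1 h2 hac hdb => ?_
    rw [D.raising c e d hce hed,
      mul_bracket _ (h1 hac (hed.le.trans hdb)) (h2 (hac.trans hce.le) hdb), neg_one_pow_deg_mul]
  exact key a b hab le_rfl le_rfl

theorem mul_lowering_of_covBy (X : A) (i : ℕ) {a b : I} (hab : a < b)
    (h : ∀ c d, a ≤ c → c ⋖ d → d ≤ b → X * D.E d c = (-1 : F) ^ (i * D.deg d c) • (D.E d c * X)) :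
    X * D.E b a = (-1 : F) ^ (i * D.deg b a) • (D.E b a * X) :=
  D.rev.mul_raising_of_covBy X i (a := toDual b) (b := toDual a) hab
    fun c d hc hcd hd => h (ofDual d) (ofDual c) hd hcd.ofDual hc

theorem commute_raising_of_covBy (X : A) {a b : I} (hab : a < b)
    (h : ∀ c d, a ≤ c → c ⋖ d → d ≤ b → X * D.E c d = D.E c d * X) :
    X * D.E a b = D.E a b * X := by
  simpa using D.mul_raising_of_covBy X 0 hab (by simpa using h)

theorem commute_lowering_of_covBy (X : A) {a b : I} (hab : a < b)
    (h : ∀ c d, a ≤ c → c ⋖ d → d ≤ b → X * D.E d c = D.E d c * X) :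
    X * D.E b a = D.E b a * X := by
  simpa using D.mul_lowering_of_covBy X 0 hab (by simpa using h)

theorem raising_comm_of_disjoint {a b c d : I} (hab : a < b) (hbc : b < c) (hcd : c < d) :
    D.E a b * D.E c d = D.E c d * D.E a b := by
  refine D.commute_raising_of_covBy _ hcd fun c' d' hc hcd' _ => ?_
  refine (D.commute_raising_of_covBy _ hab fun a' b' _ hab' hb => ?_).symm
  exact (D.distant_raising _ _ _ _ hab' hcd' (hb.trans_lt (hbc.trans_le hc))).symm

theorem lowering_comm_of_disjoint {a b c d : I} (hab : a < b) (hbc : b < c) (hcd : c < d) :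
    D.E b a * D.E d c = D.E d c * D.E b a :=
  (D.rev.raising_comm_of_disjoint (a := toDual d) (b := toDual c) (c := toDual b) (d := toDual a)
    hcd hbc hab).symm

theorem raising_lowering_comm_of_le {a b c d : I} (hab : a < b) (hbc : b ≤ c) (hcd : c < d) :
    D.E a b * D.E d c = D.E d c * D.E a b := by
  refine D.commute_lowering_of_covBy _ hcd fun c' d' hc hcd' _ => ?_
  refine (D.commute_raising_of_covBy _ hab fun a' b' _ hab' hb => ?_).symm
  have hbc' : b' ≤ c' := hb.trans (hbc.trans hc)
  have := D.raise_lower_ne a' b' c' d' hab' hcd' (hab'.lt.trans_le hbc').ne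
    (hbc'.trans_lt hcd'.lt).ne
  have h1 : D.sg a' b' d' c' = 1 := by
    rw [sg, D.deg_comm d']; exact D.sg_eq_one hab'.lt hbc' hcd'.lt
  rw [this]
  simp only [sg, deg] at h1
  rw [h1, one_smul]

theorem lowering_raising_comm_of_le {a b c d : I} (hab : a < b) (hbc : b ≤ c) (hcd : c < d) :
    D.E b a * D.E c d = D.E c d * D.E b a :=
  congrArg unop (D.opp.raising_lowering_comm_of_le hab hbc hcd).symm

/-- For equal parities, the Serre relation settles the cover `d` of `b`, and `E d c` commutes with
`E a b`. For unequal ones, `E a b` squares to zero, so both products are multiples of `E a b * E b c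
* E a b`. -/
theorem raising_same_left_of_covBy {a b c : I} (hab : a ⋖ b) (hbc : b < c) :
    D.E a b * D.E a c = ((-1) ^ D.deg a b * D.q a) • (D.E a c * D.E a b) := by
  by_cases hp : D.par a = D.par b
  · have hd : D.deg a b = 0 := by rw [deg, hp]; omega
    rw [hd, pow_zero, one_mul]
    obtain ⟨d, hbd, hdc⟩ := exists_covBy_le_of_lt hbc
    have h1 := D.serre_raising_left a b d hab hbd hp
    rcases hdc.eq_or_lt with rfl | hdc
    · exact h1
    · have h2 := D.raising_comm_of_disjoint hab.lt hbd.lt hdc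
      rw [← one_smul F (_ * D.E a b)] at h2
      rw [D.raising a d c (hab.lt.trans hbd.lt) hdc, mul_bracket _ h1 h2, mul_one]
  · have hd : D.deg a b = 1 := by
      have := D.par_le a; have := D.par_le b; rw [deg]; omega
    have h0 := D.sq_raising a b hab hp
    have hq := D.q_inv a b hp
    have hq0 := D.q_ne_zero a
    rw [D.raising a b c hab.lt hbc, hd, hq, mul_sub, sub_mul, mul_smul_comm, smul_mul_assoc,
      ← mul_assoc, h0, mul_assoc (D.E b c), h0]
    simp [mul_assoc]

/-- The composite `rev.opp` sends raising generators to raising generators, restores `q` and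
interchanges left and right. -/
theorem raising_same_right_of_covBy {a b c : I} (hab : a < b) (hbc : b ⋖ c) :
    D.E a c * D.E b c = ((-1) ^ D.deg b c * D.q c) • (D.E b c * D.E a c) := by
  have := congrArg unop (D.rev.opp.raising_same_left_of_covBy (a := toDual c) (b := toDual b)
    (c := toDual a) hbc.toDual hab)
  rw [D.deg_comm]
  change D.E a c * D.E b c = ((-1) ^ D.deg c b * (D.q c)⁻¹⁻¹) • (D.E b c * D.E a c) at this
  rwa [inv_inv] at this

theorem raising_nested_of_covBy_even {a b c d : I} (hab : a < b) (hbc : b ⋖ c) (hcd : c < d)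
    (hp : D.par b = D.par c) : D.E a d * D.E b c = D.E b c * D.E a d := by
  have hdeg : D.deg b c = 0 := by rw [deg, hp]; omega
  have hq := D.q_eq b c hp
  have h1 := D.raising_same_right_of_covBy hab hbc
  have h2 := D.raising_same_left_of_covBy hbc hcd
  rw [hdeg, pow_zero, one_mul] at h1 h2
  have hac := D.raising a b c hab hbc.lt
  have hbd := D.raising b c d hbc.lt hcd
  have had := D.raising a c d (hab.trans hbc.lt) hcd
  have had' := D.raising a b d hab (hbc.lt.trans hcd)
  rw [hq] at h1 had hbd
  exact commute_of_serre (D.q_ne_zero b) (D.sq_add_ne b) hac hbd had had' h1 h2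

/-- At the odd node the additional Serre relation covers only the immediate neighbours `z` and `w`.
The outer interval is widened to `d`, then to `a`, by bracketing with generators that commute with
`E b c`. -/
theorem raising_nested_of_covBy {a b c d : I} (hab : a < b) (hbc : b ⋖ c) (hcd : c < d) :
    D.E a d * D.E b c = D.sg a d b c • (D.E b c * D.E a d) := by
  by_cases hp : D.par b = D.par c
  · have hdeg : D.deg b c = 0 := by rw [deg, hp]; omega
    rw [D.raising_nested_of_covBy_even hab hbc hcd hp, sg, hdeg]
    simp
  · obtain ⟨z, haz, hzb⟩ := exists_le_covBy_of_lt hab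
    obtain ⟨w, hcw, hwd⟩ := exists_covBy_le_of_lt hcd
    have h := D.serre_odd_raising z b c w hzb hbc hcw hp
    have hz : D.E b c * D.E z d = (-1 : F) • (D.E z d * D.E b c) := by
      rw [← neg_one_smul F] at h
      rcases hwd.eq_or_lt with rfl | hwd
      · exact h
      · have h2 := D.raising_comm_of_disjoint hbc.lt hcw.lt hwd
        rw [← one_smul F (_ * D.E b c)] at h2
        rw [D.raising z w d (hzb.lt.trans (hbc.lt.trans hcw.lt)) hwd, mul_bracket _ h h2, mul_one]
    have ha : D.E b c * D.E a d = (-1 : F) • (D.E a d * D.E b c) := by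
      rcases haz.eq_or_lt with rfl | haz
      · exact hz
      · have h2 := (D.raising_comm_of_disjoint haz hzb.lt hbc.lt).symm
        rw [← one_smul F (_ * D.E b c)] at h2
        rw [D.raising a z d haz (hzb.lt.trans (hbc.lt.trans hcd)), mul_bracket _ h2 hz, one_mul]
    have hs : D.sg a d b c = -1 := by
      have h1 := D.par_convex _ _ _ hab hbc.lt
      have h2 := D.par_convex _ _ _ hbc.lt hcd
      have hd : D.deg b c = 1 := by
        have := D.par_le b; have := D.par_le c; rw [deg]; omega
      have hd' : D.deg a d = 1 := by
        have := D.par_le b; have := D.par_le c; have := D.par_le a; have := D.par_le d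
        rw [deg]; omega
      rw [sg, hd, hd']; simp
    rw [hs, ha, smul_smul]; simp

theorem raising_nested {a b c d : I} (hab : a < b) (hbc : b < c) (hcd : c < d) :
    D.E a d * D.E b c = D.sg a d b c • (D.E b c * D.E a d) :=
  D.mul_raising_of_covBy _ _ hbc fun _ _ hb h hc =>
    D.raising_nested_of_covBy (hab.trans_le hb) h (hc.trans_lt hcd)

/-- With `z` the cover of `a`, `E a b` is a bracket of `E a z`, handled by the simple case, and `E z
b`, nested strictly inside `E a c`. -/
theorem raising_same_left {a b c : I} (hab : a < b) (hbc : b < c) :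
    D.E a b * D.E a c = ((-1) ^ D.deg a b * D.q a) • (D.E a c * D.E a b) := by
  obtain ⟨z, haz, hzb⟩ := exists_covBy_le_of_lt hab
  have h1 := D.raising_same_left_of_covBy haz (hzb.trans_lt hbc)
  rcases hzb.eq_or_lt with rfl | hzb
  · exact h1
  · have hne : ((-1) ^ D.deg a z * D.q a) ≠ 0 := by simp [D.q_ne_zero]
    have h2 := D.raising_nested haz.lt hzb hbc
    have hs : D.sg a c z b = (-1) ^ D.deg z b := by
      have h1 := D.par_convex _ _ _ haz.lt hzb
      have h2 := D.par_convex _ _ _ hzb hbc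
      rw [sg]
      simp only [deg]
      have ha := D.par_cases a; have hb := D.par_cases b; have hc := D.par_cases c
      have hz := D.par_cases z
      rcases ha with ha | ha <;> rcases hb with hb | hb <;> rcases hc with hc | hc <;>
        rcases hz with hz | hz <;> simp [ha, hb, hc, hz] at h1 h2 ⊢
    have h3 := mul_bracket (D.q z)⁻¹ (mul_eq_smul_symm hne h1) h2
    rw [← D.raising a z b haz.lt hzb] at h3
    have hm := D.neg_one_pow_deg_mul 1 a z b
    simp only [one_mul] at hm
    rw [mul_eq_smul_symm (by simp [D.q_ne_zero, sg]) h3, hs, ← hm]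
    congr 1
    rcases neg_one_pow_eq_or F (D.deg a z) with e | e <;>
      rcases neg_one_pow_eq_or F (D.deg z b) with e' | e' <;> rw [e, e'] <;> simp

theorem raising_same_right {a b c : I} (hab : a < b) (hbc : b < c) :
    D.E a c * D.E b c = ((-1) ^ D.deg b c * D.q c) • (D.E b c * D.E a c) := by
  have := congrArg unop (D.rev.opp.raising_same_left (a := toDual c) (b := toDual b)
    (c := toDual a) hbc hab)
  rw [D.deg_comm]
  change D.E a c * D.E b c = ((-1) ^ D.deg c b * (D.q c)⁻¹⁻¹) • (D.E b c * D.E a c) at this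
  rwa [inv_inv] at this

theorem lowering_same_left {a b c : I} (hab : a < b) (hbc : b < c) :
    D.E c a * D.E c b = ((-1) ^ D.deg c b * D.q c) • (D.E c b * D.E c a) := by
  have := mul_eq_smul_symm (by simp [(D.rev).q_ne_zero]) (D.rev.raising_same_left (a := toDual c)
    (b := toDual b) (c := toDual a) hbc hab)
  change D.E c a * D.E c b = ((-1) ^ D.deg c b * (D.q c)⁻¹)⁻¹ • (D.E c b * D.E c a) at this
  rw [this]
  congr 1
  rcases neg_one_pow_eq_or F (D.deg c b) with e | e <;> simp [e]

theorem lowering_same_right {a b c : I} (hca : c < a) (hab : a < b) :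
    D.E a c * D.E b c = ((-1) ^ D.deg a c * D.q c) • (D.E b c * D.E a c) := by
  have := mul_eq_smul_symm (by simp [(D.rev).q_ne_zero]) (D.rev.raising_same_right (a := toDual b)
    (b := toDual a) (c := toDual c) hab hca)
  change D.E a c * D.E b c = ((-1) ^ D.deg a c * (D.q c)⁻¹)⁻¹ • (D.E b c * D.E a c) at this
  rw [this]
  congr 1
  rcases neg_one_pow_eq_or F (D.deg a c) with e | e <;> simp [e]

theorem lowering_nested {a b c d : I} (hab : a < b) (hbc : b < c) (hcd : c < d) :
    D.E d a * D.E c b = D.sg d a c b • (D.E c b * D.E d a) :=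
  D.rev.raising_nested (a := toDual d) (b := toDual c) (c := toDual b) (d := toDual a) hcd hbc hab

end GLSystem

/-! ### Word identities behind the overlapping and mixed relations -/

section Words

variable {F A : Type*} [Field F] [Ring A] [Algebra F A]

theorem mul_mul_of_eq_add {X Y P Q : A} {r : F} (h : X * Y = r • P + Q) (W : A) :
    X * (Y * W) = r • (P * W) + Q * W := by
  rw [← mul_assoc, h, add_mul, smul_mul_assoc]

theorem mul_mul_of_eq_smul {X Y P : A} {r : F} (h : X * Y = r • P) (W : A) :
    X * (Y * W) = r • (P * W) := by
  rw [← mul_assoc, h, smul_mul_assoc]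

theorem mul_mul_of_eq {X Y P Q : A} (h : X * Y = P * Q) (W : A) :
    X * (Y * W) = P * (Q * W) := by
  rw [← mul_assoc, h, mul_assoc]

/-- Used with `x, y, z, R` equal to `E a b, E c b, E b d, E a d`: moving `x` through the bracket `E
c d` of `y` and `z` leaves multiples of `R * y` with coefficients `t` and `-t⁻¹`. -/
theorem overlap_words {x y z R : A} {s t : F} (ht : t ≠ 0)
    (hxy : x * y = (s * t) • (y * x)) (hR : R = x * z - t⁻¹ • (z * x))
    (hRy : R * y = s • (y * R)) :
    x * (y * z - t⁻¹ • (z * y)) = s • ((y * z - t⁻¹ • (z * y)) * x) + (t - t⁻¹) • (R * y) := by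
  have hxz : x * z = t⁻¹ • (z * x) + R := by rw [hR]; abel
  simp only [mul_sub, sub_mul, smul_mul_assoc, mul_smul_comm, mul_assoc, hxy,
    mul_mul_of_eq_smul hxy, hxz, mul_mul_of_eq_add hxz, mul_add, hRy]
  match_scalars <;> field_simp

/-- The weights make the two `H₁` terms cancel, while the `H₂` terms add up to `(t - t⁻¹) • (H₂ *
X)`, absorbing the denominator. -/
theorem three_index_words {X Y Z H₁ H₂ : A} {s t : F} (ht : t ≠ 0) (ht' : t ^ 2 - 1 ≠ 0)
    (hXZ : X * Z = Z * X) (hYZ : Y * Z = s • (Z * Y) + (t - t⁻¹)⁻¹ • (H₁ - H₂))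
    (h₁ : H₁ * X = t⁻¹ • (X * H₁)) (h₂ : H₂ * X = t • (X * H₂)) :
    (X * Y - t • (Y * X)) * Z = s • (Z * (X * Y - t • (Y * X))) + H₂ * X := by
  simp only [mul_sub, sub_mul, smul_mul_assoc, mul_smul_comm, mul_assoc, hXZ,
    mul_mul_of_eq hXZ, hYZ, mul_mul_of_eq_add hYZ, mul_add, h₁, h₂]
  match_scalars <;> field_simp <;> ring

/-- Here `L` is `E a b`, the names `BC`, `CA`, `AC`, `CB` give the indices of generators, and `M`,
`N` are the Cartan factors of the three-index formulas. All terms in `CA * M * AC` and `BC * CB * N`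
cancel. -/
theorem two_index_words {L BC CA AC CB M N HA HB : A} {e₁ e₂ t : F} (ht : t ≠ 0)
    (h₂ : e₂ * e₂ = 1)
    (hBC : L * BC = e₁ • (BC * L) + M * AC) (hCA : CA * L = e₂ • (L * CA) + CB * N)
    (hA : AC * CA = e₂ • (CA * AC) + HA) (hB : CB * BC = e₁ • (BC * CB) + HB)
    (hM : M * CA = t • (CA * M)) (hN : N * BC = t⁻¹ • (BC * N)) :
    L * (BC * CA - t • (CA * BC)) = (e₁ * e₂) • ((BC * CA - t • (CA * BC)) * L) +
      (M * HA + e₂ • (HB * N)) := by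
  have hL : L * CA = e₂ • (CA * L - CB * N) := by
    rw [hCA, add_sub_cancel_right, smul_smul, h₂, one_smul]
  simp only [mul_sub, sub_mul, smul_mul_assoc, mul_smul_comm, mul_assoc, hBC,
    mul_mul_of_eq_add hBC, hL, mul_mul_of_eq_smul hL, mul_add, hA,
    mul_mul_of_eq_add hB, hN, mul_mul_of_eq_smul hM]
  match_scalars <;> field_simp <;> ring

/-- The correction `z * N` occurs once on each side of `x`; the weight `t` of `x` under `N` matches
the bracket coefficient, so the two occurrences cancel. -/
theorem nested_words {x y f z N : A} {s t : F} (ht : t ≠ 0) (hfx : f * x = x * f)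
    (hfy : f * y = s • (y * f) + z * N) (hzx : z * x = x * z) (hN : N * x = t • (x * N)) :
    f * (x * y - t⁻¹ • (y * x)) = s • ((x * y - t⁻¹ • (y * x)) * f) := by
  simp only [mul_sub, sub_mul, smul_mul_assoc, mul_smul_comm, mul_assoc, hfx, mul_mul_of_eq hfx,
    hfy, mul_mul_of_eq_add hfy, mul_add, hN, mul_mul_of_eq hzx]
  match_scalars <;> field_simp
  ring

/-- Unlike in `nested_words`, moving `M` past `f` produces `t⁻¹` against a bracket coefficient `t`,
so the corrections do not cancel. -/
theorem mixed_overlap_words {x y f z M : A} {s t : F} (ht : t ≠ 0) (hxf : x * f = f * x)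
    (hxy : x * y = s • (y * x) + M * z) (hzf : z * f = f * z) (hM : M * f = t • (f * M)) :
    x * (f * y - t • (y * f)) =
      s • ((f * y - t • (y * f)) * x) + (-((t - t⁻¹) • (M * (z * f)))) := by
  simp only [mul_sub, sub_mul, smul_mul_assoc, mul_smul_comm, mul_assoc, hxf, mul_mul_of_eq hxf,
    hxy, mul_mul_of_eq_add hxy, mul_add, hzf, mul_mul_of_eq_smul hM]
  match_scalars <;> field_simp
  ring

end Words

/-! ### Overlapping, two-index, three-index and mixed four-index relations -/

namespace GLSystem

variable {F A I : Type*} [Field F] [Ring A] [Algebra F A] [LinearOrder I] (D : GLSystem F A I)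

/-- As parity jumps at most once, both generators are odd exactly when the jump lies in the common
interval from `c` to `b`. -/
theorem sg_overlap {a c b d : I} (hac : a < c) (hcb : c < b) (hbd : b < d) :
    D.sg a b c d = (-1) ^ D.deg c b := by
  have h1 := D.par_convex _ _ _ hac hcb
  have h2 := D.par_convex _ _ _ hcb hbd
  have h3 := D.par_convex _ _ _ hac (hcb.trans hbd)
  rw [sg]
  simp only [deg]
  rcases D.par_cases a with ha | ha <;> rcases D.par_cases b with hb | hb <;>
    rcases D.par_cases c with hc | hc <;> rcases D.par_cases d with hd | hd <;>
    simp [ha, hb, hc, hd] at h1 h2 h3 ⊢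

theorem sg_nested {a b c d : I} (hab : a ≤ b) (hbc : b < c) (hcd : c ≤ d) :
    D.sg a d b c = (-1) ^ D.deg b c := by
  have h1 : D.par a = D.par b ∨ D.par b = D.par c := by
    rcases hab.eq_or_lt with rfl | hab
    · exact .inl rfl
    · exact D.par_convex _ _ _ hab hbc
  have h2 : D.par b = D.par c ∨ D.par c = D.par d := by
    rcases hcd.eq_or_lt with rfl | hcd
    · exact .inr rfl
    · exact D.par_convex _ _ _ hbc hcd
  rw [sg]
  simp only [deg]
  rcases D.par_cases a with ha | ha <;> rcases D.par_cases b with hb | hb <;>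
    rcases D.par_cases c with hc | hc <;> rcases D.par_cases d with hd | hd <;>
    simp [ha, hb, hc, hd] at h1 h2 ⊢

theorem sg_swap_left (a b c d : I) : D.sg b a c d = D.sg a b c d := by
  rw [sg, sg, D.deg_comm]

theorem sg_swap_right (a b c d : I) : D.sg a b d c = D.sg a b c d := by
  rw [sg, sg, D.deg_comm c]

variable {D} in
theorem TwoIndex.rev {a b : I} (h : D.TwoIndex a b) :
    D.rev.TwoIndex (toDual a) (toDual b) := by
  change D.E a b * D.E b a = D.sg a b b a • (D.E b a * D.E a b) +
    ((D.q a)⁻¹ - (D.q a)⁻¹⁻¹)⁻¹ • (D.Kinv a * D.K b - D.K a * D.Kinv b)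
  rw [delta_neg, inv_neg, neg_smul, ← smul_neg, neg_sub]
  exact h

variable {D} in
theorem TwoIndex.opp {a b : I} (h : D.TwoIndex a b) : D.opp.TwoIndex a b := by
  apply unop_injective
  change D.E a b * D.E b a = D.sg a b b a • (D.E b a * D.E a b) +
    ((D.q a)⁻¹ - (D.q a)⁻¹⁻¹)⁻¹ • (D.K b * D.Kinv a - D.Kinv b * D.K a)
  rw [delta_neg, inv_neg, neg_smul, ← smul_neg, neg_sub, D.K_Kinv b a, ← D.K_Kinv a b]
  exact h

variable [Finite I]

theorem raising_overlap {a c b d : I} (hac : a < c) (hcb : c < b) (hbd : b < d) :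
    D.E a b * D.E c d = D.sg a b c d • (D.E c d * D.E a b) +
      (D.q b - (D.q b)⁻¹) • (D.E a d * D.E c b) := by
  have h := D.raising_nested hac hcb hbd
  rw [D.sg_nested hac.le hcb hbd.le] at h
  rw [D.sg_overlap hac hcb hbd, D.raising c b d hcb hbd]
  exact overlap_words (D.q_ne_zero b) (D.raising_same_right hac hcb)
    (D.raising a b d (hac.trans hcb) hbd) h

theorem lowering_overlap {a c b d : I} (hac : a < c) (hcb : c < b) (hbd : b < d) :
    D.E d c * D.E b a = D.sg d c b a • (D.E b a * D.E d c) +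
      (-((D.q b - (D.q b)⁻¹) • (D.E b c * D.E d a))) := by
  have := congrArg unop (D.opp.raising_overlap hac hcb hbd)
  change D.E d c * D.E b a = D.sg a b c d • (D.E b a * D.E d c) +
      (((D.q b)⁻¹ - (D.q b)⁻¹⁻¹) • (D.E b c * D.E d a)) at this
  rwa [delta_neg, neg_smul, D.sg_comm a, ← D.sg_swap_left, ← D.sg_swap_right] at this

/-- `E a c` is split at `b`: the factor `E a b` commutes with `E c b`, and only `E b c` contributes
a Cartan term. The two-index formula is a hypothesis because its own induction uses this result. -/
theorem three_index_of_two_index {a b c : I} (hcb : c < b) (hba : b < a) (h : D.TwoIndex b c) :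
    D.E a c * D.E c b = D.sg a c c b • (D.E c b * D.E a c) + D.Kinv b * D.K c * D.E a b := by
  have hs : D.sg a c c b = D.sg b c c b := by
    rw [D.sg_swap_left c a, D.sg_swap_left c b, D.sg_nested le_rfl hcb hba.le,
      D.sg_nested le_rfl hcb le_rfl]
  have hb := D.K_mul_E_right hba.ne'
  have hb' := D.Kinv_mul_E_right hba.ne'
  have hc := D.K_mul_E_of_ne hba.ne' (hcb.trans hba).ne hcb.ne
  have hc' := D.Kinv_mul_E_of_ne hba.ne' (hcb.trans hba).ne hcb.ne
  rw [D.lowering a b c hcb hba, hs]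
  refine three_index_words (D.q_ne_zero b) (D.sq_sub_ne b)
    (D.raising_lowering_comm_of_le hcb le_rfl hba).symm h ?_ ?_
  · rw [mul_assoc, hc', ← mul_assoc, hb, smul_mul_assoc, mul_assoc]
  · rw [mul_assoc, hc, ← mul_assoc, hb', smul_mul_assoc, mul_assoc]

theorem three_index_of_two_index_rev {a b c : I} (hab : a < b) (hbc : b < c)
    (h : D.TwoIndex b c) :
    D.E a c * D.E c b = D.sg a c c b • (D.E c b * D.E a c) + D.K b * D.Kinv c * D.E a b :=
  D.rev.three_index_of_two_index (a := toDual a) (b := toDual b) (c := toDual c) hbc hab h.rev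

theorem three_index_of_two_index_opp {a b c : I} (hca : c < a) (hab : a < b)
    (h : D.TwoIndex a c) :
    D.E a c * D.E c b = D.sg a c c b • (D.E c b * D.E a c) + D.E a b * D.K a * D.Kinv c := by
  have := congrArg unop (D.opp.three_index_of_two_index hca hab h.opp)
  change D.E a c * D.E c b = D.sg b c c a • (D.E c b * D.E a c) +
    D.E a b * (D.Kinv c * D.K a) at this
  rwa [D.sg_comm b, D.sg_swap_left, D.sg_swap_right, ← D.K_Kinv, ← mul_assoc] at this

theorem three_index_of_two_index_rev_opp {a b c : I} (hba : b < a) (hac : a < c)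
    (h : D.TwoIndex a c) :
    D.E a c * D.E c b = D.sg a c c b • (D.E c b * D.E a c) + D.E a b * D.Kinv a * D.K c :=
  D.rev.three_index_of_two_index_opp (a := toDual a) (b := toDual b) (c := toDual c) hac hba h.rev

theorem two_index_of_lt (a b : I) (hab : a < b) : D.TwoIndex a b := by
  refine lt_induction (P := D.TwoIndex) (fun a b h => D.raise_lower_self a b h) (fun a c b hac hcb hA hB => ?_)
    a b hab
  have h1 := D.three_index_of_two_index_rev hac hcb hB
  have h2 := D.three_index_of_two_index_opp hac hcb hA.symm
  have hs1 : D.sg c b b c = D.sg a b b c := by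
    rw [D.sg_swap_right c b c b, D.sg_swap_right a b c b, D.sg_nested le_rfl hcb le_rfl,
      D.sg_nested hac.le hcb le_rfl]
  have hs2 : D.sg a c c a = D.sg c a a b := by
    rw [D.sg_swap_right a c a c, D.sg_swap_left a c a b, D.sg_comm a c a b,
      D.sg_nested le_rfl hac le_rfl,
      D.sg_nested le_rfl hac hcb.le]
  have hs : D.sg a b b a = D.sg a b b c * D.sg c a a b := by
    rw [D.sg_comm c]; exact (D.neg_one_pow_deg_mul _ b c a).symm
  have hne := (hac.trans hcb).ne
  rw [mul_assoc] at h2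
  have hA' := hA
  have hB' := hB
  rw [TwoIndex, hs2] at hA'
  rw [TwoIndex, hs1] at hB'
  -- `E b a` is split at `c`; the induction hypotheses on both halves supply the three-index
  -- formulas `h1`, `h2` as well as `hA'`, `hB'`.
  have key := two_index_words (D.q_ne_zero c) (D.sg_mul_self c a a b) h1 h2 hA' hB'
    (by rw [mul_assoc, D.Kinv_mul_E_of_ne hac.ne' hcb.ne' hne.symm, ← mul_assoc,
          D.K_mul_E_left hac.ne', smul_mul_assoc, mul_assoc])
    (by rw [mul_assoc, D.Kinv_mul_E_of_ne hcb.ne' hne hac.ne, ← mul_assoc,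
          D.K_mul_E_right hcb.ne', smul_mul_assoc, mul_assoc])
  rw [TwoIndex, D.lowering b c a hac hcb, key, hs]
  congr 1
  -- Once both Cartan terms carry the prefactor of index `a`, their sum telescopes: the two copies
  -- of `K c * Kinv b * (K c * Kinv a)` cancel.
  rw [smul_mul_assoc, smul_smul, ← hs2, ← D.sg_mul_delta_inv a c, ← mul_assoc, D.sg_mul_self,
    one_mul, mul_smul_comm, ← smul_add]
  congr 1
  have e1 : D.K c * D.Kinv b * (D.K a * D.Kinv c) = D.K a * D.Kinv b := by
    rw [D.K_Kinv c b, D.K_Kinv a c, mul_assoc, ← mul_assoc (D.K c), D.K_mul_Kinv, one_mul,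
      D.K_Kinv]
  have e2 : D.Kinv c * D.K b * (D.K c * D.Kinv a) = D.Kinv a * D.K b := by
    rw [← D.K_Kinv b c, mul_assoc, ← mul_assoc (D.Kinv c), D.Kinv_mul_K, one_mul, D.K_Kinv]
  have e3 : D.K c * D.Kinv b * (D.Kinv a * D.K c) = D.K c * D.Kinv b * (D.K c * D.Kinv a) := by
    rw [D.K_Kinv c a]
  rw [mul_sub, sub_mul, e1, e2, e3]
  abel

theorem two_index (a b : I) (hab : a ≠ b) : D.TwoIndex a b := by
  rcases hab.lt_or_gt with h | h
  · exact D.two_index_of_lt a b h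
  · exact (D.two_index_of_lt b a h).symm

theorem lowering_raising_nested {a b c d : I} (hac : a < c) (hcd : c < d) (hdb : d < b) :
    D.E d c * D.E a b = D.sg d c a b • (D.E a b * D.E d c) := by
  have hs : D.sg d c a b = D.sg d c c b := by
    rw [D.sg_swap_left c d a b, D.sg_swap_left c d c b, D.sg_comm c d a b, D.sg_comm c d c b,
      D.sg_nested hac.le hcd hdb.le, D.sg_nested le_rfl hcd hdb.le]
  have h2 := D.three_index_of_two_index_opp hcd hdb (D.two_index d c hcd.ne')
  rw [mul_assoc] at h2
  rw [D.raising a c b hac (hcd.trans hdb), hs]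
  refine nested_words (D.q_ne_zero c) (D.raising_lowering_comm_of_le hac le_rfl hcd).symm h2
    (D.raising_comm_of_disjoint hac hcd hdb).symm ?_
  rw [mul_assoc, D.Kinv_mul_E_right hac.ne, mul_smul_comm, ← mul_assoc,
    D.K_mul_E_of_ne hac.ne (hac.trans hcd).ne' hcd.ne', mul_assoc]

theorem raising_lowering_nested {a b c d : I} (hac : a < c) (hcd : c < d) (hdb : d < b) :
    D.E c d * D.E b a = D.sg c d b a • (D.E b a * D.E c d) :=
  D.rev.lowering_raising_nested (a := toDual b) (b := toDual a) (c := toDual d) (d := toDual c)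
    hdb hcd hac

theorem raising_lowering_overlap {a c b d : I} (hac : a < c) (hcb : c < b) (hbd : b < d) :
    D.E a b * D.E d c = D.sg a b d c • (D.E d c * D.E a b) +
      (-((D.q b - (D.q b)⁻¹) • (D.Kinv b * D.K c * D.E a c * D.E d b))) := by
  have hs : D.sg a b d c = D.sg a b b c := by
    rw [D.sg_swap_right a b c d, D.sg_swap_right a b c b, D.sg_overlap hac hcb hbd, D.sg_nested hac.le hcb le_rfl]
  have h1 := D.three_index_of_two_index_rev hac hcb (D.two_index c b hcb.ne)
  rw [D.lowering d b c hcb hbd, hs, ← D.K_Kinv, mul_assoc _ (D.E a c)]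
  refine mixed_overlap_words (D.q_ne_zero b)
    (D.raising_lowering_comm_of_le (hac.trans hcb) le_rfl hbd) h1
    (D.raising_lowering_comm_of_le hac hcb.le hbd) ?_
  rw [mul_assoc, D.Kinv_mul_E_right hbd.ne', mul_smul_comm, ← mul_assoc,
    D.K_mul_E_of_ne hbd.ne' (hcb.trans hbd).ne hcb.ne, mul_assoc]

theorem lowering_raising_overlap {a c b d : I} (hac : a < c) (hcb : c < b) (hbd : b < d) :
    D.E d c * D.E a b = D.sg d c a b • (D.E a b * D.E d c) +
      (D.q c - (D.q c)⁻¹) • (D.Kinv b * D.K c * D.E a c * D.E d b) := by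
  have := D.rev.raising_lowering_overlap (a := toDual d) (c := toDual b) (b := toDual c)
    (d := toDual a) hbd hcb hac
  change D.E d c * D.E a b = D.sg d c a b • (D.E a b * D.E d c) +
      (-(((D.q c)⁻¹ - (D.q c)⁻¹⁻¹) • (D.K c * D.Kinv b * D.E d b * D.E a c))) at this
  -- The mirrored formula has `E d b` and `E a c` in the other order; their intervals are disjoint,
  -- so they commute.
  rwa [delta_neg, neg_smul, neg_neg, D.K_Kinv, mul_assoc _ (D.E d b),
    ← D.raising_lowering_comm_of_le hac hcb.le hbd, ← mul_assoc] at this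

theorem raising_lowering_overlap_opp {a c b d : I} (hac : a < c) (hcb : c < b) (hbd : b < d) :
    D.E c d * D.E b a = D.sg c d b a • (D.E b a * D.E c d) +
      (D.q b - (D.q b)⁻¹) • (D.E b d * D.E c a * D.Kinv c * D.K b) := by
  have := congrArg unop (D.opp.raising_lowering_overlap hac hcb hbd)
  change D.E c d * D.E b a = D.sg a b d c • (D.E b a * D.E c d) +
    (-(((D.q b)⁻¹ - (D.q b)⁻¹⁻¹) • (D.E b d * (D.E c a * (D.Kinv c * D.K b))))) at this
  rw [delta_neg, neg_smul, neg_neg, D.sg_comm a, D.sg_swap_left, ← D.sg_swap_right] at this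
  simpa only [mul_assoc] using this

theorem lowering_raising_overlap_opp {a c b d : I} (hac : a < c) (hcb : c < b) (hbd : b < d) :
    D.E b a * D.E c d = D.sg b a c d • (D.E c d * D.E b a) +
      (-((D.q c - (D.q c)⁻¹) • (D.E b d * D.E c a * D.Kinv c * D.K b))) := by
  have := D.rev.raising_lowering_overlap_opp (a := toDual d) (c := toDual b) (b := toDual c)
    (d := toDual a) hbd hcb hac
  change D.E b a * D.E c d = D.sg b a c d • (D.E c d * D.E b a) +
    (((D.q c)⁻¹ - (D.q c)⁻¹⁻¹) • (D.E c a * D.E b d * D.K b * D.Kinv c)) at this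
  rw [this, delta_neg, neg_smul, mul_assoc, D.K_Kinv b c, ← mul_assoc,
    D.lowering_raising_comm_of_le hac hcb.le hbd]

end GLSystem

/-! ### `U_q[gl(m|n)]` as an instance of the abstract presentation -/

variable {m n : ℕ}

theorem Idx.covBy_iff (a b : Idx m n) : a ⋖ b ↔ (b : ℕ) = a + 1 := by
  have ha := a.2
  have hb := b.2
  constructor
  · intro h
    have hab : (a : ℕ) < b := h.lt
    by_contra hne
    exact h.2 (c := ⟨a + 1, by omega⟩) (show (a : ℕ) < a + 1 by omega)
      (show (a : ℕ) + 1 < b by omega)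
  · intro h
    refine ⟨show (a : ℕ) < b by omega, fun c hac hcb => ?_⟩
    have h1 : (a : ℕ) < c := hac
    have h2 : (c : ℕ) < b := hcb
    omega

instance : Finite (Idx m n) :=
  Finite.of_injective (fun a => (⟨a, by have := a.2; omega⟩ : Fin (m + n + 1)))
    fun a b h => Subtype.ext (Fin.mk.inj h)

theorem par_eq_zero_or_one (a : Idx m n) : par a = 0 ∨ par a = 1 := by
  rw [par]; split_ifs <;> simp

/-- Between consecutive indices parity jumps only from `m` to `m + 1`; this turns the conditions on
`m` in the presentation into parity conditions. -/
theorem par_ne_of_eq {a b : Idx m n} (ha : (a : ℕ) = m) (h : (b : ℕ) = a + 1) : par a ≠ par b := by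
  rw [par, par, if_pos ha.le, if_neg (by omega)]; simp

theorem eq_of_par_ne {a b : Idx m n} (h : (b : ℕ) = a + 1) (hp : par a ≠ par b) : (a : ℕ) = m := by
  unfold par at hp; split_ifs at hp <;> omega

theorem ne_of_par_eq {a b : Idx m n} (h : (b : ℕ) = a + 1) (hp : par a = par b) : (a : ℕ) ≠ m :=
  fun ha => par_ne_of_eq ha h hp

theorem q_ne_zero : q ≠ 0 := RatFunc.X_ne_zero

theorem q_sq_add_C_ne_zero (r : ℚ) : q ^ 2 + RatFunc.C r ≠ 0 := by
  have h := RatFunc.algebraMap_ne_zero (K := ℚ) (Polynomial.X_pow_add_C_ne_zero two_pos r)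
  simpa [q] using h

theorem q_sq_sub_one_ne_zero : q ^ 2 - 1 ≠ 0 := by
  simpa [sub_eq_add_neg] using q_sq_add_C_ne_zero (-1)

theorem q_sq_add_one_ne_zero : q ^ 2 + 1 ≠ 0 := by
  simpa using q_sq_add_C_ne_zero 1

theorem qi_eq_or (a : Idx m n) : qi a = q ∨ qi a = q⁻¹ := by
  rcases par_eq_zero_or_one a with h | h <;> simp [qi, h]

theorem mk_eq {x y : Free m n} (h : Rel m n x y) :
    RingQuot.mkAlgHom 𝕂 (Rel m n) x = RingQuot.mkAlgHom 𝕂 (Rel m n) y :=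
  RingQuot.mkAlgHom_rel 𝕂 h

theorem gcomm_eq {A : Type} [Ring A] [Algebra 𝕂 A] (i j : ℕ) (X Y : A) :
    gcomm i j X Y = X * Y - (-1 : 𝕂) ^ (i * j) • (Y * X) := by
  rw [gcomm]
  rcases Nat.even_or_odd (i * j) with h | h <;> simp [h.neg_one_pow]

theorem map_brE (a b c d : Idx m n) :
    RingQuot.mkAlgHom 𝕂 (Rel m n) (Free.brE a b c d) = brE a b c d := by
  simp [Free.brE, brE, gcomm, E]

theorem brE_eq_iff (a b c d : Idx m n) (r : U m n) :
    brE a b c d = r ↔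
      E a b * E c d = (-1 : 𝕂) ^ (degE a b * degE c d) • (E c d * E a b) + r := by
  rw [brE, gcomm_eq, sub_eq_iff_eq_add, add_comm]

/-- The generators of `U_q[gl(m|n)]`. -/
noncomputable def system (m n : ℕ) : GLSystem 𝕂 (U m n) (Idx m n) where
  par := par
  q := qi
  K := K
  Kinv := Kinv
  E := E
  par_le a := by rcases par_eq_zero_or_one a with h | h <;> omega
  par_convex a b c hab hbc := by
    have h1 : (a : ℕ) < b := hab
    have h2 : (b : ℕ) < c := hbc
    unfold par; split_ifs <;> omega
  q_ne_zero a := by rcases qi_eq_or a with h | h <;> simp [h, q_ne_zero]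
  q_eq a b h := by rw [qi, qi, h]
  q_inv a b h := by
    rcases par_eq_zero_or_one a with ha | ha <;> rcases par_eq_zero_or_one b with hb | hb <;>
      simp [qi, ha, hb] at h ⊢
  sq_sub_ne a := by
    rcases qi_eq_or a with h | h <;> rw [h]
    · exact q_sq_sub_one_ne_zero
    · exact GLSystem.sq_inv_sub_ne q_ne_zero q_sq_sub_one_ne_zero
  sq_add_ne a := by
    rcases qi_eq_or a with h | h <;> rw [h]
    · exact q_sq_add_one_ne_zero
    · exact GLSystem.sq_inv_add_ne q_ne_zero q_sq_add_one_ne_zero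
  K_mul_Kinv a := by simpa [K, Kinv] using mk_eq (Rel.K_mul_Kinv a)
  Kinv_mul_K a := by simpa [K, Kinv] using mk_eq (Rel.Kinv_mul_K a)
  K_K a b := by simpa [K] using mk_eq (Rel.K_K a b)
  K_Kinv a b := by simpa [K, Kinv] using mk_eq (Rel.K_Kinv a b)
  Kinv_Kinv a b := by simpa [Kinv] using mk_eq (Rel.Kinv_Kinv a b)
  raising a c b hac hcb := by simpa [E] using mk_eq (Rel.nonsimple_raising a c b hac hcb)
  lowering a c b hbc hca := by simpa [E] using mk_eq (Rel.nonsimple_lowering a c b hbc hca)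
  K_E_covBy a b c h := by
    rw [Idx.covBy_iff, Idx.covBy_iff] at h
    have := mk_eq (Rel.K_E a b c h)
    rw [map_mul, map_smul, map_mul] at this
    convert this <;> rfl
  raise_lower_ne a a' b b' ha hb hab _ := by
    rw [Idx.covBy_iff] at ha hb
    have := mk_eq (Rel.raise_lower a a' b b' ha hb)
    rw [map_brE, if_neg hab, map_zero, brE_eq_iff, add_zero] at this
    exact this
  raise_lower_self a a' ha := by
    rw [Idx.covBy_iff] at ha
    have := mk_eq (Rel.raise_lower a a' a a' ha ha)
    rw [map_brE, if_pos rfl, brE_eq_iff, map_smul, map_sub, map_mul, map_mul] at this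
    exact this
  distant_raising a a' b b' ha hb hab := by
    rw [Idx.covBy_iff] at ha hb
    have h : (a' : ℕ) < b := hab
    simpa [E] using mk_eq (Rel.distant_raising a a' b b' ha hb (by omega))
  distant_lowering a a' b b' ha hb hab := by
    rw [Idx.covBy_iff] at ha hb
    have h : (a' : ℕ) < b := hab
    simpa [E] using mk_eq (Rel.distant_lowering a a' b b' ha hb (by omega))
  sq_raising a a' ha hp := by
    rw [Idx.covBy_iff] at ha
    simpa [E, pow_two] using mk_eq (Rel.sq_raising a a' (eq_of_par_ne ha hp) ha)
  sq_lowering a a' ha hp := by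
    rw [Idx.covBy_iff] at ha
    simpa [E, pow_two] using mk_eq (Rel.sq_lowering a a' (eq_of_par_ne ha hp) ha)
  serre_raising_left a b c hab hbc hp := by
    rw [Idx.covBy_iff] at hab hbc
    simpa [E] using mk_eq (Rel.serre_b a b c (ne_of_par_eq hab hp) hab (by omega))
  serre_raising_right a b c hab hbc hp := by
    rw [Idx.covBy_iff] at hab hbc
    simpa [E] using mk_eq (Rel.serre_d a b c (ne_of_par_eq hbc hp) hab hbc)
  serre_lowering_left a b c hab hbc hp := by
    rw [Idx.covBy_iff] at hab hbc
    simpa [E] using mk_eq (Rel.serre_a a b c (ne_of_par_eq hab hp) hab (by omega))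
  serre_lowering_right a b c hab hbc hp := by
    rw [Idx.covBy_iff] at hab hbc
    simpa [E] using mk_eq (Rel.serre_c a b c (ne_of_par_eq hbc hp) hab hbc)
  serre_odd_raising a b c d hab hbc hcd hp := by
    rw [Idx.covBy_iff] at hab hbc hcd
    have hm := eq_of_par_ne hbc hp
    have := mk_eq (Rel.serre_odd_raising a b c d hm hab hbc (by omega))
    rw [map_brE, map_zero, brE_eq_iff, add_zero] at this
    rw [this]
    simp [degE, par, hm, hbc, hcd, show (a : ℕ) ≤ m by omega]
    exact neg_one_smul 𝕂 (E a d * E b c)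
  serre_odd_lowering a b c d hab hbc hcd hp := by
    rw [Idx.covBy_iff] at hab hbc hcd
    have hm := eq_of_par_ne hbc hp
    have := mk_eq (Rel.serre_odd_lowering a b c d hm hab hbc (by omega))
    rw [map_brE, map_zero, brE_eq_iff, add_zero] at this
    rw [this]
    simp [degE, par, hm, hbc, hcd, show (a : ℕ) ≤ m by omega]
    exact neg_one_smul 𝕂 (E d a * E c b)

/-! ### Translation to graded commutators -/

theorem brE_eq_of {a b c d : Idx m n} {r : U m n}
    (h : (system m n).E a b * (system m n).E c d =
      (system m n).sg a b c d • ((system m n).E c d * (system m n).E a b) + r) :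
    brE a b c d = r :=
  (brE_eq_iff a b c d r).2 h

theorem brE_eq_zero_of {a b c d : Idx m n}
    (h : (system m n).E a b * (system m n).E c d =
      (system m n).sg a b c d • ((system m n).E c d * (system m n).E a b)) :
    brE a b c d = 0 :=
  brE_eq_of (h.trans (add_zero _).symm)

theorem brE_flip (a b c d : Idx m n) :
    brE a b c d = -((system m n).sg a b c d • brE c d a b) := by
  have h1 := (brE_eq_iff a b c d _).1 rfl
  rw [(brE_eq_iff c d a b _).1 rfl, mul_comm (degE c d)] at h1
  have h2 := (system m n).sg_mul_self a b c d
  change _ = (system m n).sg a b c d • _ + _ at h1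
  change _ = (system m n).sg a b c d • ((system m n).sg a b c d • _ + _) + _ at h1
  rw [smul_add, smul_smul, h2, one_smul, add_assoc] at h1
  exact eq_neg_of_add_eq_zero_right (left_eq_add.1 h1)

theorem brE_eq_zero_of_flip {a b c d : Idx m n} (h : brE c d a b = 0) : brE a b c d = 0 := by
  rw [brE_flip, h, smul_zero, neg_zero]

theorem brE_eq_zero_of_comm {a b c d a' b' c' d' : Idx m n} (hab : a < b) (hbc : b ≤ c)
    (hcd : c < d) (h₁ : a' = a ∧ b' = b ∨ a' = b ∧ b' = a) (h₂ : c' = c ∧ d' = d ∨ c' = d ∧ d' = c)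
    (h : (system m n).E a' b' * (system m n).E c' d' =
      (system m n).E c' d' * (system m n).E a' b') : brE a' b' c' d' = 0 := by
  apply brE_eq_zero_of
  have hs := (system m n).sg_eq_one hab hbc hcd
  have hs' : (system m n).sg a' b' c' d' = 1 := by
    rcases h₁ with ⟨rfl, rfl⟩ | ⟨rfl, rfl⟩ <;> rcases h₂ with ⟨rfl, rfl⟩ | ⟨rfl, rfl⟩ <;>
      simpa only [GLSystem.sg, (system m n).deg_comm] using hs
  rw [hs', one_smul, h]

theorem brE_eq_zero_of_disjoint {a b c d : Idx m n} (hab : a < b) (hbc : b < c) (hcd : c < d) :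
    brE a b c d = 0 ∧ brE a b d c = 0 ∧ brE b a c d = 0 ∧ brE b a d c = 0 := by
  refine ⟨brE_eq_zero_of_comm hab hbc.le hcd (by simp) (by simp) ?_,
    brE_eq_zero_of_comm hab hbc.le hcd (by simp) (by simp) ?_,
    brE_eq_zero_of_comm hab hbc.le hcd (by simp) (by simp) ?_,
    brE_eq_zero_of_comm hab hbc.le hcd (by simp) (by simp) ?_⟩
  · exact (system m n).raising_comm_of_disjoint hab hbc hcd
  · exact (system m n).raising_lowering_comm_of_le hab hbc.le hcd
  · exact (system m n).lowering_raising_comm_of_le hab hbc.le hcd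
  · exact (system m n).lowering_comm_of_disjoint hab hbc hcd

theorem brE_eq_zero_of_nested {a b c d : Idx m n} (hac : a < c) (hcd : c < d) (hdb : d < b) :
    brE a b c d = 0 ∧ brE a b d c = 0 ∧ brE b a c d = 0 ∧ brE b a d c = 0 :=
  ⟨brE_eq_zero_of ((system m n).raising_nested hac hcd hdb),
    brE_eq_zero_of_flip (brE_eq_zero_of ((system m n).lowering_raising_nested hac hcd hdb)),
    brE_eq_zero_of_flip (brE_eq_zero_of ((system m n).raising_lowering_nested hac hcd hdb)),
    brE_eq_zero_of ((system m n).lowering_nested hac hcd hdb)⟩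

theorem brE_eq_zero_of_between {a b c : Idx m n} (hac : a < c) (hcb : c < b) :
    brE c a c b = 0 ∧ brE a c b c = 0 :=
  ⟨brE_eq_zero_of_comm hac le_rfl hcb (by simp) (by simp)
      ((system m n).lowering_raising_comm_of_le hac le_rfl hcb),
    brE_eq_zero_of_comm hac le_rfl hcb (by simp) (by simp)
      ((system m n).raising_lowering_comm_of_le hac le_rfl hcb)⟩

theorem brE_two_index (a b : Idx m n) :
    brE a b b a = (Dl a)⁻¹ • (K a * Kinv b - Kinv a * K b) := by
  by_cases hab : a = b
  · subst hab
    -- On the diagonal `E` takes its default value, and the Cartan side is `1 - 1`.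
    have hE : E a a = (0 : U m n) := by simp [E, Free.E]
    have h1 := (system m n).K_mul_Kinv a
    have h2 := (system m n).Kinv_mul_K a
    change K a * Kinv a = 1 at h1
    change Kinv a * K a = 1 at h2
    rw [brE, hE, h1, h2]
    simp [gcomm]
  · exact brE_eq_of ((system m n).two_index a b hab)

/-- This is the overlap rule with the two generators interchanged; the sign from graded antisymmetry
cancels the one from reordering the nested pair `E c b`, `E a d`. -/
theorem brE_raising_overlap_flip {a b c d : Idx m n} (hca : c < a) (had : a < d) (hdb : d < b) :
    brE a b c d = -(Dl d • (E a d * E c b)) := by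
  have hs : (system m n).sg a b c d = (system m n).sg c b a d := by
    rw [(system m n).sg_comm, (system m n).sg_overlap hca had hdb,
      (system m n).sg_nested hca.le had hdb.le]
  have h := (system m n).raising_nested hca had hdb
  change E c b * E a d = (system m n).sg c b a d • (E a d * E c b) at h
  rw [brE_flip, brE_eq_of ((system m n).raising_overlap hca had hdb), hs]
  change -(_ • (Dl d • (E c b * E a d))) = _
  rw [h, smul_comm, smul_smul _ _ (E a d * E c b), GLSystem.sg_mul_self, one_smul]

theorem brE_lowering_overlap_flip {a b c d : Idx m n} (hac : a < c) (hcb : c < b) (hbd : b < d) :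
    brE b a d c = Dl b • (E d a * E b c) := by
  have hs : (system m n).sg b a d c = (system m n).sg d a b c := by
    rw [(system m n).sg_swap_left a b, (system m n).sg_swap_right a b c d,
      (system m n).sg_swap_left a d, (system m n).sg_swap_right a d c b,
      (system m n).sg_overlap hac hcb hbd, (system m n).sg_nested hac.le hcb hbd.le]
  have h := (system m n).lowering_nested hac hcb hbd
  change E d a * E b c = (system m n).sg d a b c • (E b c * E d a) at h
  rw [brE_flip, brE_eq_of ((system m n).lowering_overlap hac hcb hbd), hs, h]
  change -(_ • -(Dl b • (E b c * E d a))) = _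
  rw [smul_neg, neg_neg, smul_comm]

end UqGL

open UqGL in
theorem lemma2 (m n : ℕ) :
    -- two indices
    (∀ a b : Idx m n, brE a b b a = (Dl a)⁻¹ • (K a * Kinv b - Kinv a * K b)) ∧
    -- three distinct indices
    (∀ a b c : Idx m n,
      (c < b ∧ b < a → brE a c c b = Kinv b * K c * E a b) ∧
      (c < a ∧ a < b → brE a c c b = E a b * K a * Kinv c) ∧
      (b < a ∧ a < c → brE a c c b = E a b * Kinv a * K c) ∧
      (a < b ∧ b < c → brE a c c b = K b * Kinv c * E a b)) ∧
    (∀ a b c : Idx m n, (a < c ∧ c < b) ∨ (b < c ∧ c < a) →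
      brE c a c b = 0 ∧ brE a c b c = 0) ∧
    (∀ a b c : Idx m n,
      (a < b ∧ b < c → E c a * E c b = ((-1) ^ degE c b * qi c) • (E c b * E c a)) ∧
      (c < a ∧ a < b → E c a * E c b = ((-1) ^ degE c a * qi c) • (E c b * E c a)) ∧
      (a < b ∧ b < c → E a c * E b c = ((-1) ^ degE b c * qi c) • (E b c * E a c)) ∧
      (c < a ∧ a < b → E a c * E b c = ((-1) ^ degE a c * qi c) • (E b c * E a c))) ∧
    -- four distinct indices, disjoint or nested intervals
    (∀ a b c d : Idx m n,
      (a < c ∧ c < d ∧ d < b) ∨ (a < b ∧ b < c ∧ c < d) ∨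
        (c < a ∧ a < b ∧ b < d) ∨ (c < d ∧ d < a ∧ a < b) →
      brE a b c d = 0 ∧ brE a b d c = 0 ∧ brE b a c d = 0 ∧ brE b a d c = 0) ∧
    -- four distinct indices, overlapping intervals
    (∀ a b c d : Idx m n, a < c ∧ c < b ∧ b < d →
      brE a b c d = Dl b • (E a d * E c b) ∧
      brE b a d c = Dl b • (E d a * E b c) ∧
      brE a b d c = -(Dl b • (Kinv b * K c * E a c * E d b)) ∧
      brE b a c d = -(Dl c • (E b d * E c a * Kinv c * K b))) ∧
    (∀ a b c d : Idx m n, c < a ∧ a < d ∧ d < b →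
      brE a b c d = -(Dl d • (E a d * E c b)) ∧
      brE b a d c = -(Dl d • (E d a * E b c)) ∧
      brE a b d c = Dl d • (E d b * E a c * Kinv a * K d) ∧
      brE b a c d = Dl a • (Kinv d * K a * E c a * E b d)) := by
  refine ⟨brE_two_index, fun a b c => ⟨?_, ?_, ?_, ?_⟩, fun a b c h => ?_,
    fun a b c => ⟨?_, ?_, ?_, ?_⟩, fun a b c d h => ?_, fun a b c d h => ?_, fun a b c d h => ?_⟩
  · exact fun ⟨h₁, h₂⟩ => brE_eq_of
      ((system m n).three_index_of_two_index h₁ h₂ ((system m n).two_index b c h₁.ne'))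
  · exact fun ⟨h₁, h₂⟩ => brE_eq_of
      ((system m n).three_index_of_two_index_opp h₁ h₂ ((system m n).two_index a c h₁.ne'))
  · exact fun ⟨h₁, h₂⟩ => brE_eq_of
      ((system m n).three_index_of_two_index_rev_opp h₁ h₂ ((system m n).two_index a c h₂.ne))
  · exact fun ⟨h₁, h₂⟩ => brE_eq_of
      ((system m n).three_index_of_two_index_rev h₁ h₂ ((system m n).two_index b c h₂.ne))
  · rcases h with ⟨h₁, h₂⟩ | ⟨h₁, h₂⟩
    · exact brE_eq_zero_of_between h₁ h₂
    · exact (brE_eq_zero_of_between h₁ h₂).imp brE_eq_zero_of_flip brE_eq_zero_of_flip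
  · exact fun ⟨h₁, h₂⟩ => (system m n).lowering_same_left h₁ h₂
  · exact fun ⟨h₁, h₂⟩ => (system m n).raising_same_left h₁ h₂
  · exact fun ⟨h₁, h₂⟩ => (system m n).raising_same_right h₁ h₂
  · exact fun ⟨h₁, h₂⟩ => (system m n).lowering_same_right h₁ h₂
  · rcases h with ⟨h₁, h₂, h₃⟩ | ⟨h₁, h₂, h₃⟩ | ⟨h₁, h₂, h₃⟩ | ⟨h₁, h₂, h₃⟩
    · exact brE_eq_zero_of_nested h₁ h₂ h₃
    · exact brE_eq_zero_of_disjoint h₁ h₂ h₃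
    · obtain ⟨e₁, e₂, e₃, e₄⟩ := brE_eq_zero_of_nested h₁ h₂ h₃
      exact ⟨brE_eq_zero_of_flip e₁, brE_eq_zero_of_flip e₃, brE_eq_zero_of_flip e₂,
        brE_eq_zero_of_flip e₄⟩
    · obtain ⟨e₁, e₂, e₃, e₄⟩ := brE_eq_zero_of_disjoint h₁ h₂ h₃
      exact ⟨brE_eq_zero_of_flip e₁, brE_eq_zero_of_flip e₃, brE_eq_zero_of_flip e₂,
        brE_eq_zero_of_flip e₄⟩
  · obtain ⟨h₁, h₂, h₃⟩ := h
    exact ⟨brE_eq_of ((system m n).raising_overlap h₁ h₂ h₃),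
      brE_lowering_overlap_flip h₁ h₂ h₃,
      brE_eq_of ((system m n).raising_lowering_overlap h₁ h₂ h₃),
      brE_eq_of ((system m n).lowering_raising_overlap_opp h₁ h₂ h₃)⟩
  · obtain ⟨h₁, h₂, h₃⟩ := h
    exact ⟨brE_raising_overlap_flip h₁ h₂ h₃,
      brE_eq_of ((system m n).lowering_overlap h₁ h₂ h₃),
      brE_eq_of ((system m n).raising_lowering_overlap_opp h₁ h₂ h₃),
      brE_eq_of ((system m n).lowering_raising_overlap h₁ h₂ h₃)⟩
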